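/- An integral domain $\mathcal{O}$ with field of fractions $K$ is called a Krull ring if there is a family $(v_i)_{i\in I}$ of discrete valuations of $K$ (with value group $\mathbb{Z}$) such that $\mathcal{O}=\bigcap_{i}\{x\in K : v_i(x)\ge 0\}$ and such that for every $x\in K^\times$ one has $v_i(x)\ne 0$ for only finitely many $i$. An algebra $B$ over a field $k$ is called split semisimple if it is semisimple and $\mathrm{End}_B(V)\simeq k$ for every simple $B$-module $V$. Let $\mathcal{O}$ be a Krull ring with field of fractions $K$, and let $A$ be an $\mathcal{O}$-algebra which is free and finitely generated as an $\mathcal{O}$-module. Let $t:A\to\mathcal{O}$ be a symmetrizing form, i.e. an $\mathcal{O}$-linear map with $t(ab)=t(ba)$ for all $a,b\in A$ such that $a\mapsto(x\mapsto t(ax))$ is an isomorphism $A\to\mathrm{Hom}_{\mathcal{O}}(A,\mathcal{O})$, and let $t^K$ be its $K$-linear extension to $KA:=K\otimes_{\mathcal{O}}A$. Assume that $KA$ is split semisimple. For a simple $KA$-module $V$ with character $\chi_V:KA\to K$, let $\chi_V^\vee$ be the (central) element of $KA$ with $t^K(\chi_V^\vee a)=\chi_V(a)$ for all $a\in KA$,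 and let the Schur element $s_V\in K$ be the scalar by which $\chi_V^\vee$ acts on $V$. Let $\theta:\mathcal{O}\to L$ be a ring homomorphism into a field $L$ such that $L$ is the field of fractions of $\theta(\mathcal{O})$, and suppose that $\mathrm{Ker}\,\theta$ is a prime ideal of $\mathcal{O}$ of height $1$. Then every Schur element $s_V$ is well defined and lies in $\mathcal{O}$, and $LA:=L\otimes_{\mathcal{O}}A$ (formed via $\theta$) is split semisimple if and only if $\theta(s_V)\neq 0$ for every simple $KA$-module $V$. -/

import Mathlib

open scoped TensorProduct

universe u v w x

/-- An integral domain `R` with field of fractions `F` is a Krull ring if there is a family of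
discrete valuations of `F` (value group `ℤ`, written multiplicatively with a zero adjoined) such
that `R` is the intersection of their valuation rings, and such that every nonzero element of `F`
is a unit for all but finitely many of them. -/
def IsKrullRing (R : Type u) (F : Type v) [CommRing R] [IsDomain R] [Field F] [Algebra R F]
    [IsFractionRing R F] : Prop :=
  ∃ S : Set (Valuation F (WithZero (Multiplicative ℤ))),
    (∀ ν ∈ S, Function.Surjective ν) ∧
    (∀ x : F, (∀ ν ∈ S, ν x ≤ 1) ↔ x ∈ Set.range (algebraMap R F)) ∧
    (∀ x : F, x ≠ 0 → {ν ∈ S | ν x ≠ 1}.Finite)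

/-- A `K`-algebra `B` is split if `End_B(V) ≃ K` for every simple `B`-module `V`. (Every simple
`B`-module is isomorphic to a quotient of `B`, so the universe of `B` suffices.) -/
def IsSplitAlgebra (K : Type u) (B : Type v) [Field K] [Ring B] [Algebra K B] : Prop :=
  ∀ (V : Type v) [AddCommGroup V] [Module B V] [Module K V] [IsScalarTower K B V],
    IsSimpleModule B V → Nonempty (Module.End B V ≃ₐ[K] K)

/-- A `K`-algebra is split semisimple if it is semisimple and split. -/
def IsSplitSemisimple (K : Type u) (B : Type v) [Field K] [Ring B] [Algebra K B] : Prop :=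
  IsSemisimpleRing B ∧ IsSplitAlgebra K B

/-- `t` is a symmetrizing form on the `R`-algebra `A`: a trace function such that
`a ↦ (x ↦ t (a * x))` is an isomorphism from `A` onto its `R`-dual. -/
structure IsSymmetrizingForm {R : Type u} {A : Type v} [CommRing R] [Ring A] [Algebra R A]
    (t : A →ₗ[R] R) : Prop where
  trace_comm : ∀ a b : A, t (a * b) = t (b * a)
  bijective : Function.Bijective (fun a : A => t ∘ₗ LinearMap.mulLeft R a)

/-- The extension of scalars `t^K : K ⊗ A → K` of a linear form `t : A → R`, with
`t^K (c ⊗ a) = c * t a`. -/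
noncomputable def extendForm {R : Type u} (K : Type v) {A : Type w} [CommRing R] [Field K]
    [Algebra R K] [Ring A] [Algebra R A] (t : A →ₗ[R] R) : (K ⊗[R] A) →ₗ[K] K :=
  (TensorProduct.AlgebraTensorModule.rid R K K).toLinearMap ∘ₗ t.baseChange K

/-- The character of a `B`-module `V`: `b` is sent to the trace of its action on the `K`-vector
space `V`. -/
noncomputable def moduleCharacter (K : Type u) (B : Type v) (V : Type w) [Field K] [Ring B]
    [Algebra K B] [AddCommGroup V] [Module B V] [Module K V] [IsScalarTower K B V] : B →ₗ[K] K :=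
  LinearMap.trace K V ∘ₗ (Algebra.lsmul K K V : B →ₐ[K] Module.End K V).toLinearMap

/-- `s` is the Schur element of the simple `B`-module `V` with respect to the symmetrizing form
`τ` on `B`: if `z` is the element of `B` with `τ (z * b) = χ_V b` for all `b`, then `s` is the
scalar by which `z` acts on `V`. -/
def IsSchurElement {K : Type u} {B : Type v} [Field K] [Ring B] [Algebra K B] (τ : B →ₗ[K] K)
    (V : Type w) [AddCommGroup V] [Module B V] [Module K V] [IsScalarTower K B V] (s : K) : Prop :=
  ∃ z : B, (∀ b : B, τ (z * b) = moduleCharacter K B V b) ∧ ∀ x : V, z • x = s • x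

/-- A ring homomorphism `θ : R → L` into a field is a specialization of `R` if `L` is the field
of fractions of `θ(R)`. -/
def IsSpecialization {R : Type u} {L : Type v} [CommRing R] [Field L] (θ : R →+* L) : Prop :=
  IsFractionRing θ.range L

/-! Split semisimplicity makes `KA` a product of matrix algebras, where the trace form is `t^K = ∑
cᵢ trᵢ`. With dual bases `β`, `β'` of `A`, the Casimir identity `cᵢ ∑ β X β' = tr X`
(`casimir_matrix`) forces `cᵢ ≠ 0`, and the Schur elements are the inverses `cᵢ⁻¹`
(`isSchurElement_iff`).

Integrality is checked at each valuation of the Krull family. Its ring is principal, so the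
representation on `V` becomes integral there (`exists_integral_splitting`). Hence `χ_V` takes values
in `O` on `A`, `χ_V^∨` comes from `A`, and the scalar by which it acts is an entry of an integral
matrix (`exists_schurElement`).

For the criterion, the localization `R` of `O` at the height-one kernel is a discrete valuation ring
(`IsKrullRing.exists_valuation`), so the matrix representations of `KA` have models over `R` and
reduce to `L`. If `LA` is split semisimple, `1` is a relative trace; but the reduction of the `i`-th
representation kills all relative traces when `θ(sᵢ) = 0` (`reduceRep_casimir_eq_zero`). If no
`θ(sᵢ)` vanishes, clearing denominators in `t^K = ∑ sᵢ⁻¹ trᵢ` and reducing shows that the reductions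
jointly detect `t^L`, hence are jointly injective (`eq_zero_of_reduceRep_eq_zero`); equality of
dimensions makes `LA` a product of matrix algebras. -/

theorem moduleCharacter_eq_trace {k : Type u} {B : Type v} [Field k] [Ring B] [Algebra k B]
    {ι : Type*} {d : ι → ℕ} {φ : B ≃ₐ[k] Π i, Matrix (Fin (d i)) (Fin (d i)) k}
    {V : Type w} [AddCommGroup V] [Module B V] [Module k V] [IsScalarTower k B V]
    {i : ι} {e : (Fin (d i) → k) ≃ₗ[k] V}
    (he : ∀ (b : B) (f : Fin (d i) → k), e (Matrix.mulVec (φ b i) f) = b • e f) (b : B) :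
    moduleCharacter k B V b = (φ b i).trace := by
  have : (Algebra.lsmul k k V : B →ₐ[k] Module.End k V) b = e.conj (Matrix.toLin' (φ b i)) := by
    ext x
    simp [LinearEquiv.conj_apply, he]
  simp only [moduleCharacter, LinearMap.comp_apply, AlgHom.toLinearMap_apply]
  rw [this, LinearMap.trace_conj', Matrix.trace_toLin'_eq]

/-! ### Split semisimple algebras as products of matrix algebras. -/

section SplitSemisimple

variable {k : Type u} {B : Type v} [Field k] [Ring B] [Algebra k B]
  {ι : Type*} [Fintype ι] [DecidableEq ι] {d : ι → ℕ}

/-- A simple module over a product of matrix algebras is the natural module of one factor. -/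
theorem exists_intertwiner_of_isSimpleModule
    (φ : B ≃ₐ[k] Π i, Matrix (Fin (d i)) (Fin (d i)) k)
    (V : Type w) [AddCommGroup V] [Module B V] [Module k V] [IsScalarTower k B V]
    (hV : IsSimpleModule B V) :
    ∃ (i : ι) (e : (Fin (d i) → k) ≃ₗ[k] V), ∀ (b : B) (f : Fin (d i) → k),
      e (Matrix.mulVec (φ b i) f) = b • e f := by
  set E : ∀ i, Fin (d i) → Fin (d i) → B :=
    fun i p q => φ.symm (Pi.single i (Matrix.single p q 1)) with hE
  have hφE : ∀ i p q, φ (E i p q) = Pi.single i (Matrix.single p q 1) := by simp [hE]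
  have hone : (1 : B) = ∑ i, ∑ p, E i p p := by
    apply φ.injective
    ext i p q
    simp only [map_sum, hφE, map_one, Finset.sum_apply, Matrix.sum_apply]
    rw [Finset.sum_eq_single i]
    · simp only [Pi.single_eq_same, Pi.one_apply, Matrix.one_apply, Matrix.single_apply, ite_and,
        Finset.sum_ite_eq', Finset.mem_univ, if_true]
    · intro j _ hj
      simp [Pi.single_eq_of_ne hj.symm]
    · simp
  obtain ⟨v, hv⟩ : ∃ v : V, v ≠ 0 := by
    have := hV.nontrivial
    exact exists_ne 0
  obtain ⟨i, r, hr⟩ : ∃ i r, E i r r • v ≠ 0 := by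
    by_contra! h
    apply hv
    rw [← one_smul B v, hone, Finset.sum_smul]
    simp [Finset.sum_smul, h]
  have hEE : ∀ p q q' s, E i p q * E i q' s = if q = q' then E i p s else 0 := by
    intro p q q' s
    apply φ.injective
    rw [map_mul, hφE, hφE, ← Pi.single_mul]
    split_ifs with h
    · subst h; simp [hφE]
    · simp [Matrix.single_mul_single_of_ne, h]
  have hbE : ∀ b p q, b * E i p q = ∑ p', φ b i p' p • E i p' q := by
    intro b p q
    apply φ.injective
    ext j p' q'
    simp only [map_mul, map_sum, map_smul, hφE, Pi.mul_apply, Finset.sum_apply, Matrix.sum_apply,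
      Pi.smul_apply, Matrix.smul_apply, Matrix.mul_apply]
    by_cases hj : j = i
    · subst hj
      simp [Matrix.single_apply, ite_and]
    · simp [Pi.single_eq_of_ne hj]
  set v₀ := E i r r • v with hv₀
  let f : (Fin (d i) → k) →ₗ[k] V :=
    { toFun := fun x => ∑ p, x p • E i p r • v₀
      map_add' := fun x y => by simp [add_smul, Finset.sum_add_distrib]
      map_smul' := fun c x => by simp [mul_smul, Finset.smul_sum] }
  have hf : ∀ (b : B) (x : Fin (d i) → k), f (Matrix.mulVec (φ b i) x) = b • f x := by
    intro b x
    have hc : ∀ (c : k) (w : V), b • c • w = c • b • w := fun c w => by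
      rw [← algebraMap_smul B c w, ← algebraMap_smul B c (b • w), smul_smul, smul_smul,
        Algebra.commutes]
    simp only [f, LinearMap.coe_mk, AddHom.coe_mk, Finset.smul_sum, hc, smul_smul b, hbE,
      Finset.sum_smul, Matrix.mulVec, dotProduct, smul_assoc]
    rw [Finset.sum_comm]
    refine Finset.sum_congr rfl fun p _ => ?_
    refine Finset.sum_congr rfl fun q _ => ?_
    rw [← mul_smul (x p), mul_comm]
  have hinj : Function.Injective f := by
    rw [← LinearMap.ker_eq_bot, LinearMap.ker_eq_bot']
    intro x hx
    ext p
    -- The matrix unit `E i r p` isolates the `p`-th coordinate as a multiple of `v₀ ≠ 0`.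
    have h1 : E i r p • f x = x p • v₀ := by
      rw [← hf, hφE]
      have : Matrix.mulVec (Matrix.single r p (1 : k)) x = Pi.single r (x p) := by
        simp [Matrix.single_mulVec, Pi.single]
      rw [Pi.single_eq_same, this]
      simp only [f, LinearMap.coe_mk, AddHom.coe_mk]
      rw [Finset.sum_eq_single r]
      · simp [hv₀, smul_smul, hEE]
      · intro q _ hq
        simp [hq]
      · simp
    rw [hx, smul_zero] at h1
    exact (smul_eq_zero.mp h1.symm).resolve_right hr
  have hsurj : Function.Surjective f := by
    let N : Submodule B V :=
      { carrier := Set.range f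
        add_mem' := by rintro _ _ ⟨a, rfl⟩ ⟨b, rfl⟩; exact ⟨a + b, map_add _ _ _⟩
        zero_mem' := ⟨0, map_zero _⟩
        smul_mem' := by rintro b _ ⟨a, rfl⟩; exact ⟨_, hf b a⟩ }
    have hN : N = ⊤ := by
      refine (eq_bot_or_eq_top N).resolve_left fun h => ?_
      have h2 : f (Pi.single r 1) ∈ N := ⟨_, rfl⟩
      rw [h, Submodule.mem_bot, ← map_zero f] at h2
      have := congr_fun (hinj h2) r
      simp at this
    intro y
    have : y ∈ N := hN ▸ Submodule.mem_top
    exact this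
  exact ⟨i, LinearEquiv.ofBijective f ⟨hinj, hsurj⟩, hf⟩

/-- A product of matrix algebras over a field is split semisimple. -/
theorem isSplitSemisimple_of_algEquiv (φ : B ≃ₐ[k] Π i, Matrix (Fin (d i)) (Fin (d i)) k) :
    IsSplitSemisimple k B := by
  refine ⟨φ.symm.toRingEquiv.isSemisimpleRing, ?_⟩
  intro V _ _ _ _ hV
  obtain ⟨i, e, he⟩ := exists_intertwiner_of_isSimpleModule φ V hV
  have hnt := hV.nontrivial
  refine ⟨(AlgEquiv.ofBijective (Algebra.ofId k (Module.End B V)) ⟨?_, ?_⟩).symm⟩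
  · exact (algebraMap k (Module.End B V)).injective
  · intro g
    obtain ⟨x, hx⟩ := exists_ne (0 : V)
    obtain ⟨r⟩ : Nonempty (Fin (d i)) := by
      by_contra h
      rw [not_nonempty_iff] at h
      apply hx
      rw [← e.apply_symm_apply x, Subsingleton.elim (e.symm x) 0, map_zero]
    let u := φ.symm (Pi.single i (Matrix.single r r 1))
    have hu : φ u i = Matrix.single r r 1 := by simp [u]
    set v₀ := e (Pi.single r 1) with hv₀
    have huv : u • v₀ = v₀ := by
      rw [hv₀, ← he, hu]
      simp [Matrix.single_mulVec, Pi.single]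
    -- The rank-one idempotent `u` fixes `v₀` and commutes with `g`, so `g v₀` stays on the line of
    -- `v₀`. Thus `g` has an eigenvector, and Schur's lemma makes it scalar.
    have hgv : g v₀ = (e.symm (g v₀) r) • v₀ := by
      conv_lhs => rw [← huv, map_smul, ← e.apply_symm_apply (g v₀), ← he, hu]
      rw [hv₀, ← map_smul]
      congr 1
      ext q
      simp [Matrix.single_mulVec, Pi.single_apply, Function.update_apply]
    refine ⟨e.symm (g v₀) r, ?_⟩
    have hker : LinearMap.ker (g - algebraMap k (Module.End B V) (e.symm (g v₀) r)) = ⊤ := by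
      refine (eq_bot_or_eq_top _).resolve_left fun h => ?_
      have : v₀ ∈ LinearMap.ker (g - algebraMap k (Module.End B V) (e.symm (g v₀) r)) := by
        rw [LinearMap.mem_ker, LinearMap.sub_apply, sub_eq_zero]
        exact hgv
      rw [h, Submodule.mem_bot, hv₀, map_eq_zero_iff _ e.injective] at this
      simpa using congr_fun this r
    exact (sub_eq_zero.mp (LinearMap.ker_eq_top.mp hker)).symm

/-- A split semisimple algebra is a product of matrix algebras over the base field. -/
theorem IsSplitSemisimple.exists_algEquiv (h : IsSplitSemisimple k B) :
    ∃ (n : ℕ) (d : Fin n → ℕ), (∀ i, NeZero (d i)) ∧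
      Nonempty (B ≃ₐ[k] Π i, Matrix (Fin (d i)) (Fin (d i)) k) := by
  obtain ⟨hss, hsp⟩ := h
  obtain ⟨n, S, d, hS, hd, ⟨e⟩⟩ :=
    IsSemisimpleRing.exists_algEquiv_pi_matrix_end_mulOpposite k B
  refine ⟨n, d, hd, ⟨e.trans (AlgEquiv.piCongrRight fun i => ?_)⟩⟩
  -- Splitness turns the endomorphism ring into `k`, and commutativity of `k` removes the opposite.
  exact ((hsp (S i) (hS i)).some.op.trans (AlgEquiv.toOpposite k k).symm).mapMatrix

/-- Every matrix factor of a semisimple algebra affords a simple module. -/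
theorem exists_simpleModule_intertwiner [IsSemisimpleRing B] [∀ i, NeZero (d i)]
    (φ : B ≃ₐ[k] Π i, Matrix (Fin (d i)) (Fin (d i)) k) (i : ι) :
    ∃ V : Submodule B B, IsSimpleModule B V ∧
      ∃ e : (Fin (d i) → k) ≃ₗ[k] V, ∀ (b : B) (f : Fin (d i) → k),
        e (Matrix.mulVec (φ b i) f) = b • e f := by
  set ε := φ.symm (Pi.single i 1) with hε
  have hφε : φ ε = Pi.single i 1 := by simp [hε]
  have hne : ε ≠ 0 := by
    intro h
    have : (Pi.single i 1 : Π i, Matrix (Fin (d i)) (Fin (d i)) k) = 0 := by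
      rw [← hφε, h, map_zero]
    have := congr_fun this i
    simp at this
  have hcomm : ∀ b, b * ε = ε * b := by
    intro b
    apply φ.injective
    rw [map_mul, map_mul, hφε]
    ext j : 1
    by_cases hj : j = i
    · subst hj; simp
    · simp [Pi.single_eq_of_ne hj]
  have hidem : ε * ε = ε := by
    apply φ.injective
    rw [map_mul, hφε, ← Pi.single_mul, one_mul]
  -- The central idempotent `ε` acts as `1` on this ideal and as `0` on the modules of the other
  -- factors, so a simple submodule of it belongs to factor `i`.
  let N : Submodule B B := Submodule.span B {ε}
  have hNnt : Nontrivial N := by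
    rw [Submodule.nontrivial_iff_ne_bot]
    simpa [N] using hne
  obtain ⟨m, hm⟩ := IsSemisimpleModule.exists_simple_submodule B N
  have hV : IsSimpleModule B (m.map N.subtype) :=
    IsSimpleModule.congr (Submodule.equivMapOfInjective _ N.injective_subtype m).symm
  obtain ⟨j, e, he⟩ := exists_intertwiner_of_isSimpleModule φ (m.map N.subtype) hV
  have hji : i = j := by
    by_contra hij
    have hnt := hV.nontrivial
    obtain ⟨x, hx⟩ := exists_ne (0 : m.map N.subtype)
    have h1 : ε • x = x := by
      apply Subtype.ext
      obtain ⟨y, hy, hyx⟩ := x.2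
      obtain ⟨b, hb⟩ := Submodule.mem_span_singleton.mp y.2
      change ε * x.1 = x.1
      rw [← hyx]
      simp only [Submodule.subtype_apply, ← hb, smul_eq_mul]
      rw [hcomm, ← mul_assoc, hidem]
    apply hx
    rw [← h1, ← e.apply_symm_apply x, ← he, hφε, Pi.single_eq_of_ne (Ne.symm hij)]
    simp
  subst hji
  exact ⟨_, hV, e, he⟩

/-- A trace function on a product of matrix algebras is a combination of the traces. -/
theorem exists_eq_sum_mul_trace [∀ i, NeZero (d i)]
    (φ : B ≃ₐ[k] Π i, Matrix (Fin (d i)) (Fin (d i)) k) (τ : B →ₗ[k] k)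
    (hτ : ∀ a b, τ (a * b) = τ (b * a)) :
    ∃ c : ι → k, ∀ b, τ b = ∑ i, c i * (φ b i).trace := by
  set E : ∀ i, Fin (d i) → Fin (d i) → B :=
    fun i p q => φ.symm (Pi.single i (Matrix.single p q 1)) with hE
  have hEE : ∀ i p q q' s, E i p q * E i q' s = if q = q' then E i p s else 0 := by
    intro i p q q' s
    simp only [hE, ← map_mul, ← Pi.single_mul]
    split_ifs with h
    · subst h; simp
    · simp [Matrix.single_mul_single_of_ne, h]
  have hτE : ∀ i p q, τ (E i p q) = if p = q then τ (E i 0 0) else 0 := by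
    intro i p q
    -- Swapping the two factors under `τ` gives `0` off the diagonal and a value independent of `p`
    -- on it.
    have h1 : E i p q = E i p 0 * E i 0 q := by simp [hEE]
    rw [h1, hτ, hEE]
    by_cases h : p = q
    · simp [h]
    · simp [h, Ne.symm h]
  obtain ⟨c, hc⟩ : ∃ c : ι → k, ∀ i, τ (E i 0 0) = c i := ⟨_, fun _ => rfl⟩
  simp only [hc] at hτE
  refine ⟨c, fun b => ?_⟩
  have hb : b = ∑ i, ∑ p, ∑ q, φ b i p q • E i p q := by
    apply φ.injective
    ext j p' q'
    simp only [map_sum, map_smul, hE, AlgEquiv.apply_symm_apply, Finset.sum_apply,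
      Matrix.sum_apply, Pi.smul_apply, Matrix.smul_apply]
    rw [Finset.sum_eq_single j]
    · simp [Matrix.single_apply, ite_and]
    · intro i _ hi
      simp [Pi.single_eq_of_ne hi.symm]
    · simp
  conv_lhs => rw [hb]
  simp only [map_sum, map_smul, hτE, smul_eq_mul, mul_ite, mul_zero, Finset.sum_ite_eq,
    Finset.mem_univ, if_true, Matrix.trace, Matrix.diag_apply, Finset.mul_sum]
  exact Finset.sum_congr rfl fun i _ => Finset.sum_congr rfl fun p _ => mul_comm _ _

/-! ### Dual bases, the Casimir identity and Schur elements. -/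

section DualBases

variable {κ : Type*} [Fintype κ] {τ : B →ₗ[k] k} {β β' : κ → B} {c : ι → k}
  {φ : B ≃ₐ[k] Π i, Matrix (Fin (d i)) (Fin (d i)) k}

/-- The Casimir identity in a matrix factor: if `β`, `β'` are dual bases for a trace form
`τ = ∑ cᵢ trᵢ`, then `cᵢ ∑ β X β' = tr X` in the `i`-th factor. -/
theorem casimir_matrix (hc : ∀ b, τ b = ∑ i, c i * (φ b i).trace)
    (hβ : ∀ w, ∑ j, τ (β' j * w) • β j = w) (i : ι) (X : Matrix (Fin (d i)) (Fin (d i)) k) :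
    c i • ∑ j, φ (β j) i * X * φ (β' j) i = X.trace • 1 := by
  -- Expand the matrix unit at `(s, r)` in the dual bases and read off its `(p, q)` entry.
  have key : ∀ p q r s, c i * ∑ j, φ (β j) i p q * φ (β' j) i r s =
      if p = s ∧ q = r then 1 else 0 := by
    intro p q r s
    have h := hβ (φ.symm (Pi.single i (Matrix.single s r 1)))
    have h2 := congr_arg (fun w => φ w i p q) h
    have hτ : ∀ j, τ (β' j * φ.symm (Pi.single i (Matrix.single s r 1))) =
        c i * φ (β' j) i r s := by
      intro j
      rw [hc, Finset.sum_eq_single i]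
      · congr 1
        simp [Matrix.trace_mul_single]
      · intro l _ hl
        simp [Pi.single_eq_of_ne hl]
      · simp
    simp only [map_sum, map_smul, hτ, Finset.sum_apply, Matrix.sum_apply, Pi.smul_apply,
      Matrix.smul_apply, smul_eq_mul, AlgEquiv.apply_symm_apply, Pi.single_eq_same,
      Matrix.single_apply] at h2
    rw [Finset.mul_sum]
    simp only [eq_comm (a := p), eq_comm (a := q)]
    rw [← h2]
    exact Finset.sum_congr rfl fun j _ => by ring
  ext p s
  have h3 : (c i • ∑ j, φ (β j) i * X * φ (β' j) i) p s =
      ∑ r, ∑ q, X q r * (c i * ∑ j, φ (β j) i p q * φ (β' j) i r s) := by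
    simp only [Matrix.smul_apply, Matrix.sum_apply, Matrix.mul_apply, smul_eq_mul,
      Finset.mul_sum, Finset.sum_mul]
    rw [Finset.sum_comm]
    refine Finset.sum_congr rfl fun r _ => ?_
    rw [Finset.sum_comm]
    refine Finset.sum_congr rfl fun q _ => Finset.sum_congr rfl fun j _ => by ring
  rw [h3]
  simp only [key, Matrix.smul_apply, Matrix.one_apply, Matrix.trace, Matrix.diag_apply]
  by_cases hps : p = s
  · simp [hps]
  · simp [hps]

/-- Otherwise the Casimir identity for a diagonal matrix unit would read `0 = 1`. -/
theorem coeff_ne_zero [∀ i, NeZero (d i)] (hc : ∀ b, τ b = ∑ i, c i * (φ b i).trace)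
    (hβ : ∀ w, ∑ j, τ (β' j * w) • β j = w) (i : ι) : c i ≠ 0 := by
  intro h
  have h1 := casimir_matrix hc hβ i (Matrix.single 0 0 1)
  rw [h, zero_smul, Matrix.trace_single_eq_same, one_smul] at h1
  exact zero_ne_one h1

/-- In a split semisimple algebra with a symmetrizing form, `1` is a relative trace. -/
theorem exists_casimir_eq_one [∀ i, NeZero (d i)] (hc : ∀ b, τ b = ∑ i, c i * (φ b i).trace)
    (hβ : ∀ w, ∑ j, τ (β' j * w) • β j = w) : ∃ a, ∑ j, β j * a * β' j = 1 := by
  -- The `i`-th component is chosen with trace `c i`, which then cancels in the Casimir identity.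
  refine ⟨φ.symm fun i => Matrix.single 0 0 (c i), φ.injective ?_⟩
  ext i : 1
  have h1 := casimir_matrix hc hβ i (Matrix.single 0 0 (c i))
  rw [Matrix.trace_single_eq_same] at h1
  have h2 := smul_right_injective _ (coeff_ne_zero hc hβ i) h1
  simpa using h2

variable {V : Type w} [AddCommGroup V] [Module B V] [Module k V] [IsScalarTower k B V]
  {i : ι} {e : (Fin (d i) → k) ≃ₗ[k] V}

/-- The Schur element of the simple module of the `i`-th factor is the inverse of the
coefficient of the `i`-th trace in the form. -/
theorem isSchurElement_iff [∀ i, NeZero (d i)] (hc : ∀ b, τ b = ∑ i, c i * (φ b i).trace)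
    (hβ : ∀ w, ∑ j, τ (β' j * w) • β j = w) (hτ : ∀ a b, τ (a * b) = τ (b * a))
    (he : ∀ (b : B) (f : Fin (d i) → k), e (Matrix.mulVec (φ b i) f) = b • e f) (s : k) :
    IsSchurElement τ V s ↔ s = (c i)⁻¹ := by
  have hci := coeff_ne_zero hc hβ i
  -- This is `χ_V^∨`: the `i`-th central idempotent divided by `c i`. The dual bases make it unique.
  set z₀ : B := φ.symm (Pi.single i ((c i)⁻¹ • 1)) with hz₀
  have hφz₀ : φ z₀ = Pi.single i ((c i)⁻¹ • 1) := by simp [hz₀]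
  have hz₀τ : ∀ b, τ (z₀ * b) = moduleCharacter k B V b := by
    intro b
    rw [moduleCharacter_eq_trace he, hc, Finset.sum_eq_single i]
    · simp [hφz₀, hci]
    · intro l _ hl
      simp [hφz₀, Pi.single_eq_of_ne hl]
    · simp
  have hz₀V : ∀ x : V, z₀ • x = (c i)⁻¹ • x := by
    intro x
    rw [← e.apply_symm_apply x, ← he, hφz₀, ← map_smul]
    simp [Matrix.smul_mulVec]
  constructor
  · rintro ⟨z, hz, hzV⟩
    have hzz : z = z₀ := by
      rw [← hβ z, ← hβ z₀]
      refine Finset.sum_congr rfl fun j _ => ?_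
      rw [hτ, hz, hτ, hz₀τ]
    have h1 := hzV (e (Pi.single 0 1))
    rw [hzz, hz₀V] at h1
    have hne : e (Pi.single 0 1) ≠ 0 := by
      rw [Ne, map_eq_zero_iff _ e.injective]
      simp
    exact (smul_left_injective _ hne h1).symm
  · rintro rfl
    exact ⟨z₀, hz₀τ, hz₀V⟩

end DualBases

end SplitSemisimple

/-! ### Integral models of representations over a principal ideal domain. -/

section Lattice

variable {O R K A : Type*} [CommRing O] [CommRing R] [IsDomain R] [IsPrincipalIdealRing R]
  [Field K] [Algebra O R] [Algebra O K] [Algebra R K] [IsScalarTower O R K] [IsFractionRing R K]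
  [Ring A] [Algebra O A] [Module.Finite O A]

variable (R) in
/-- A matrix representation over the fraction field of a principal ideal domain is equivalent to
an integral one. -/
theorem exists_integral_conj {n : ℕ} (ρ : A →ₐ[O] Matrix (Fin n) (Fin n) K) :
    ∃ (e : Matrix (Fin n) (Fin n) K ≃ₐ[K] Matrix (Fin n) (Fin n) K)
      (ρ' : A →ₐ[O] Matrix (Fin n) (Fin n) R),
      ∀ a, (ρ' a).map (algebraMap R K) = e (ρ a) := by
  -- An `A`-stable lattice: finite generation of `A` over `O` makes it finitely generated, so it is
  -- free over `R`, and a basis of it makes every `ρ a` integral.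
  let M : Submodule R (Fin n → K) :=
    Submodule.span R (Set.range fun x : A × Fin n => Matrix.mulVec (ρ x.1) (Pi.single x.2 1))
  have hM : ∀ (a : A), ∀ m ∈ M, Matrix.mulVec (ρ a) m ∈ M := by
    intro a m hm
    induction hm using Submodule.span_induction with
    | mem x hx =>
      obtain ⟨⟨a', p⟩, rfl⟩ := hx
      refine Submodule.subset_span ⟨⟨a * a', p⟩, ?_⟩
      simp only [map_mul, Matrix.mulVec_mulVec]
    | zero => rw [Matrix.mulVec_zero]; exact M.zero_mem
    | add x y _ _ hx hy => rw [Matrix.mulVec_add]; exact M.add_mem hx hy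
    | smul r x _ hx => rw [Matrix.mulVec_smul]; exact M.smul_mem r hx
  obtain ⟨G, hG⟩ := Module.Finite.fg_top (R := O) (M := A)
  have hfg : M.FG := by
    let N : Submodule R (Fin n → K) := Submodule.span R
      (Set.range fun x : G × Fin n => Matrix.mulVec (ρ x.1) (Pi.single x.2 1))
    have hNM : M = N := by
      apply le_antisymm
      · refine Submodule.span_le.mpr ?_
        rintro _ ⟨⟨a, p⟩, rfl⟩
        have ha : a ∈ Submodule.span O (G : Set A) := hG ▸ Submodule.mem_top
        change Matrix.mulVec (ρ a) (Pi.single p 1) ∈ N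
        induction ha using Submodule.span_induction with
        | mem x hx => exact Submodule.subset_span ⟨⟨⟨x, hx⟩, p⟩, rfl⟩
        | zero => rw [map_zero, Matrix.zero_mulVec]; exact N.zero_mem
        | add x y _ _ hx hy => rw [map_add, Matrix.add_mulVec]; exact N.add_mem hx hy
        | smul r x _ hx =>
          rw [map_smul, Matrix.smul_mulVec, ← algebraMap_smul R r]
          exact N.smul_mem _ hx
      · refine Submodule.span_mono ?_
        rintro _ ⟨⟨a, p⟩, rfl⟩
        exact ⟨⟨a, p⟩, rfl⟩
    rw [hNM]
    exact Submodule.fg_span (Set.finite_range _)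
  have hspan : Submodule.span K (M : Set (Fin n → K)) = ⊤ := by
    rw [eq_top_iff, ← (Pi.basisFun K (Fin n)).span_eq]
    refine Submodule.span_mono ?_
    rintro _ ⟨p, rfl⟩
    refine Submodule.subset_span ⟨⟨1, p⟩, ?_⟩
    simp only [map_one, Matrix.one_mulVec, Pi.basisFun_apply]
  have : Submodule.IsLattice K M := ⟨hfg, hspan⟩
  have hrank : Module.finrank R M = n := by
    rw [Submodule.IsLattice.finrank_of_pi K M, Fintype.card_fin]
  let b : Module.Basis (Fin n) R M := Module.finBasisOfFinrankEq R M hrank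
  let bK := b.extendOfIsLattice K
  have hrepr : ∀ (m : M) (p : Fin n), bK.repr m.1 p = algebraMap R K (b.repr m p) := by
    intro m p
    have h1 : m.1 = ∑ q, algebraMap R K (b.repr m q) • bK q := by
      conv_lhs => rw [← b.sum_repr m]
      simp only [bK, Module.Basis.extendOfIsLattice_apply, algebraMap_smul,
        Submodule.coe_sum, Submodule.coe_smul]
    rw [h1, bK.repr_sum_self]
  let e := (Matrix.toLinAlgEquiv' (R := K) (n := Fin n)).trans (LinearMap.toMatrixAlgEquiv bK)
  have hint : ∀ a p q, ∃ r : R, algebraMap R K r = e (ρ a) p q := by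
    intro a p q
    have hmem : Matrix.mulVec (ρ a) (bK q) ∈ M := by
      apply hM
      simp [bK]
    refine ⟨b.repr ⟨_, hmem⟩ p, ?_⟩
    rw [← hrepr]
    simp [e, LinearMap.toMatrixAlgEquiv_apply]
  let f : Matrix (Fin n) (Fin n) R →ₐ[O] Matrix (Fin n) (Fin n) K :=
    (IsScalarTower.toAlgHom O R K).mapMatrix
  have hf : Function.Injective f :=
    Matrix.map_injective (FaithfulSMul.algebraMap_injective R K)
  let g : A →ₐ[O] Matrix (Fin n) (Fin n) K := (e.restrictScalars O).toAlgHom.comp ρ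
  have hg : ∀ a, g a ∈ f.range := by
    intro a
    choose r hr using hint a
    refine ⟨Matrix.of r, ?_⟩
    ext p q
    exact hr p q
  refine ⟨e, (AlgEquiv.ofInjective f hf).symm.toAlgHom.comp (g.codRestrict _ hg), fun a => ?_⟩
  exact congr_arg Subtype.val ((AlgEquiv.ofInjective f hf).apply_symm_apply ⟨g a, hg a⟩)

variable (R) in
/-- A splitting of `K ⊗ A` can be chosen integral over a principal ideal domain with fraction
field `K`. -/
theorem exists_integral_splitting {ι : Type*} {d : ι → ℕ}
    (φ : (K ⊗[O] A) ≃ₐ[K] Π i, Matrix (Fin (d i)) (Fin (d i)) K) :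
    ∃ (φ' : (K ⊗[O] A) ≃ₐ[K] Π i, Matrix (Fin (d i)) (Fin (d i)) K)
      (ρ : ∀ i, A →ₐ[O] Matrix (Fin (d i)) (Fin (d i)) R),
      ∀ i a, (ρ i a).map (algebraMap R K) = φ' (1 ⊗ₜ a) i := by
  have key := fun i => exists_integral_conj R
    (((Pi.evalAlgHom K (fun i => Matrix (Fin (d i)) (Fin (d i)) K) i).comp
      φ.toAlgHom).restrictScalars O |>.comp
        (Algebra.TensorProduct.includeRight : A →ₐ[O] K ⊗[O] A))
  choose e ρ h using key
  exact ⟨φ.trans (AlgEquiv.piCongrRight e), ρ, fun i a => h i a⟩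

end Lattice

/-! ### Localizing a Krull ring at a prime of height one. -/

section Krull

/-- The value set contains `0` and `1`, and a subset of `ℤ` with zero adjoined that has two elements
is never densely ordered. -/
theorem isPrincipalIdealRing_valuationSubring {K : Type*} [Field K]
    (ν : Valuation K (WithZero (Multiplicative ℤ))) :
    IsPrincipalIdealRing ν.valuationSubring := by
  rw [(Valuation.valuationSubring.integers ν).isPrincipalIdealRing_iff_not_denselyOrdered,
    WithZero.denselyOrdered_set_iff_subsingleton]
  simpa using ν.toMonoidWithZeroHom.range_nontrivial

variable {O : Type u} {K : Type v} [CommRing O] [IsDomain O] [Field K] [Algebra O K]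
  [IsFractionRing O K]

/-- The localization of a Krull ring at a prime of height one is the valuation ring of a discrete
valuation. -/
theorem IsKrullRing.exists_valuation (hO : IsKrullRing O K) (P : Ideal O) [P.IsPrime]
    (hP : P.height = 1) :
    ∃ ν : Valuation K (WithZero (Multiplicative ℤ)), Function.Surjective ν ∧
      (∀ x : O, ν (algebraMap O K x) ≤ 1) ∧ (∀ x : O, ν (algebraMap O K x) < 1 ↔ x ∈ P) ∧
      ∀ x : K, ν x ≤ 1 → ∃ b ∉ P, ∃ y, algebraMap O K b * x = algebraMap O K y := by
  classical
  obtain ⟨S, hsurj, hint, hfin⟩ := hO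
  have hle : ∀ ν ∈ S, ∀ x : O, ν (algebraMap O K x) ≤ 1 :=
    fun ν hν x => (hint _).mpr ⟨x, rfl⟩ ν hν
  have hinj := FaithfulSMul.algebraMap_injective O K
  obtain ⟨a, haP, ha0⟩ : ∃ a ∈ P, a ≠ 0 := by
    by_contra! h
    have : P = ⊥ := by
      rw [eq_bot_iff]
      intro x hx
      simpa using h x hx
    rw [this, Ideal.height_bot] at hP
    exact zero_ne_one hP
  have haK : algebraMap O K a ≠ 0 := by simpa using ha0
  -- a valuation of the family whose centre lies in `P` has centre `P`
  have hcentre : ∀ ν ∈ S, (∀ x : O, ν (algebraMap O K x) < 1 → x ∈ P) →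
      ∀ x : O, ν (algebraMap O K x) < 1 ↔ x ∈ P := by
    intro ν hν h
    let Q : Ideal O :=
      { carrier := {x | ν (algebraMap O K x) < 1}
        add_mem' := fun {x y} hx hy => by
          change ν _ < 1
          rw [map_add]
          exact ν.map_add_lt hx hy
        zero_mem' := by simp
        smul_mem' := fun c x hx => by
          change ν _ < 1
          rw [smul_eq_mul, map_mul, map_mul]
          exact (mul_le_of_le_one_left' (hle ν hν c)).trans_lt hx }
    have hQ : Q.IsPrime := by
      rw [Ideal.isPrime_iff]
      refine ⟨fun h => ?_, fun {x y} hxy => ?_⟩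
      · have : (1 : O) ∈ Q := h ▸ Submodule.mem_top
        change ν (algebraMap O K 1) < 1 at this
        simp at this
      · by_contra! hc
        have hx : ν (algebraMap O K x) = 1 := le_antisymm (hle ν hν x) (not_lt.mp hc.1)
        have hy : ν (algebraMap O K y) = 1 := le_antisymm (hle ν hν y) (not_lt.mp hc.2)
        change ν (algebraMap O K (x * y)) < 1 at hxy
        rw [map_mul, map_mul, hx, hy, one_mul] at hxy
        exact lt_irrefl _ hxy
    have hQ0 : Q ≠ ⊥ := by
      intro hbot
      obtain ⟨y, hy⟩ := hsurj ν hν (WithZero.exp (-1))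
      obtain ⟨p, q, hq, rfl⟩ := IsFractionRing.div_surjective (A := O) y
      have hp : p ∈ Q := by
        change ν (algebraMap O K p) < 1
        have hqK : algebraMap O K q ≠ 0 := by simpa using nonZeroDivisors.ne_zero hq
        have h1 : algebraMap O K p = (algebraMap O K p / algebraMap O K q) * algebraMap O K q := by
          field_simp
        rw [h1, map_mul, hy]
        refine mul_lt_one_of_lt_of_le ?_ (hle ν hν q)
        rw [← WithZero.exp_zero, WithZero.exp_lt_exp]
        norm_num
      rw [hbot, Ideal.mem_bot] at hp
      rw [hp, map_zero, zero_div, map_zero] at hy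
      exact WithZero.exp_ne_zero hy.symm
    have hQP : Q ≤ P := h
    -- A strict chain `⊥ < Q < P` would give `P` height at least two.
    have hQP' : Q = P := by
      by_contra hne
      have : P.FiniteHeight := ⟨Or.inr (by rw [hP]; exact ENat.one_ne_top)⟩
      have h1 := Ideal.height_strict_mono_of_isPrime_of_isPrime (lt_of_le_of_ne hQP hne)
      have : Q.FiniteHeight := ⟨Or.inr (h1.trans_le le_top).ne⟩
      have h2 := Ideal.height_strict_mono_of_isPrime_of_isPrime (bot_lt_iff_ne_bot.mpr hQ0)
      rw [hP] at h1
      rw [Order.lt_one_iff] at h1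
      rw [h1] at h2
      exact not_lt_zero h2
    intro x
    rw [← hQP']
    rfl
  -- finitely many valuations centred at `P` cut out the localization
  let good : Finset (Valuation K (WithZero (Multiplicative ℤ))) → Prop := fun T =>
    (∀ ν ∈ T, ν ∈ S ∧ ∀ x : O, ν (algebraMap O K x) < 1 ↔ x ∈ P) ∧
    ∀ x : K, (∀ ν ∈ T, ν x ≤ 1) → ∃ b ∉ P, ∃ y, algebraMap O K b * x = algebraMap O K y
  have hgood : ∃ T, good T := by
    have hT : {ν ∈ S | ∀ x : O, ν (algebraMap O K x) < 1 ↔ x ∈ P}.Finite :=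
      (hfin _ haK).subset fun ν hν => ⟨hν.1, ((hν.2 a).mpr haP).ne⟩
    refine ⟨hT.toFinset, fun ν hν => by simpa using hν, fun x hx => ?_⟩
    by_cases hx0 : x = 0
    · exact ⟨1, (Ideal.ne_top_iff_one P).mp Ideal.IsPrime.ne_top', 0, by simp [hx0]⟩
    have hF : {ν ∈ S | 1 < ν x}.Finite :=
      (hfin x hx0).subset fun ν hν => ⟨hν.1, hν.2.ne'⟩
    -- A valuation with `ν x > 1` is not centred at `P`, so some `b ∉ P` has `ν b < 1`; a power of
    -- `b` cancels the pole of `x`. Only finitely many `ν` need this, and the product of these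
    -- powers is the denominator.
    have hβ : ∀ ν : Valuation K (WithZero (Multiplicative ℤ)), ∃ β ∉ P,
        ν ∈ S → 1 < ν x → ν (algebraMap O K β) * ν x ≤ 1 := by
      intro ν
      by_cases h : ν ∈ S ∧ 1 < ν x
      · obtain ⟨b, hb1, hbP⟩ : ∃ b : O, ν (algebraMap O K b) < 1 ∧ b ∉ P := by
          by_contra! hb
          have hνT : ν ∈ hT.toFinset := by
            rw [Set.Finite.mem_toFinset]
            exact ⟨h.1, hcentre ν h.1 hb⟩
          exact absurd (hx ν hνT) (not_le.mpr h.2)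
        have hb0 : ν (algebraMap O K b) ≠ 0 := by
          rw [Valuation.ne_zero_iff]
          rintro hb
          rw [map_eq_zero_iff _ hinj] at hb
          exact hbP (hb ▸ P.zero_mem)
        obtain ⟨n, hn⟩ := MulArchimedean.arch (ν x)
          ((one_lt_inv₀ (zero_lt_iff.mpr hb0)).mpr hb1)
        refine ⟨b ^ n, fun hb => hbP (Ideal.IsPrime.mem_of_pow_mem ‹_› n hb), fun _ _ => ?_⟩
        rw [map_pow, map_pow]
        calc ν (algebraMap O K b) ^ n * ν x
            ≤ ν (algebraMap O K b) ^ n * (ν (algebraMap O K b))⁻¹ ^ n := by gcongr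
          _ = 1 := by rw [← mul_pow, mul_inv_cancel₀ hb0, one_pow]
      · exact ⟨1, (Ideal.ne_top_iff_one P).mp Ideal.IsPrime.ne_top', fun h1 h2 => absurd ⟨h1, h2⟩ h⟩
    choose β hβP hβ using hβ
    refine ⟨∏ ν ∈ hF.toFinset, β ν, fun h => ?_, ?_⟩
    · obtain ⟨ν, -, hν⟩ := (Ideal.IsPrime.prod_mem_iff (p := P)).mp h
      exact hβP ν hν
    · suffices h : algebraMap O K (∏ ν ∈ hF.toFinset, β ν) * x ∈ Set.range (algebraMap O K) by
        obtain ⟨y, hy⟩ := h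
        exact ⟨y, hy.symm⟩
      rw [← hint]
      intro ν hν
      rw [map_mul]
      by_cases h : 1 < ν x
      · have hmem : ν ∈ hF.toFinset := by simpa using ⟨hν, h⟩
        rw [← Finset.mul_prod_erase _ _ hmem, map_mul, map_mul, mul_right_comm]
        exact mul_le_one' (hβ ν hν h) (hle ν hν _)
      · exact mul_le_one' (hle ν hν _) (not_lt.mp h)
  obtain ⟨T, hT⟩ := exists_minimal_of_wellFoundedLT good hgood
  obtain ⟨⟨hTS, hTx⟩, hTmin⟩ := hT
  -- If `T` were empty, all of `K`, including the inverse of `a ∈ P`, would lie in the localization.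
  have hTne : T.Nonempty := by
    rw [Finset.nonempty_iff_ne_empty]
    rintro rfl
    obtain ⟨b, hb, y, hy⟩ := hTx (algebraMap O K a)⁻¹ (by simp)
    apply hb
    have : b = y * a := by
      apply hinj
      rw [map_mul, ← hy]
      field_simp
    rw [this]
    exact P.mul_mem_left _ haP
  obtain ⟨ν, hνT⟩ := hTne
  obtain ⟨hνS, hνP⟩ := hTS ν hνT
  -- by minimality, `ν` is the only valuation in `T`
  have honly : ∀ μ ∈ T, μ = ν := by
    intro μ hμT
    by_contra hμν
    have hng : ¬ good (T.erase ν) := by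
      intro h
      have := hTmin h (Finset.erase_subset _ _) hνT
      simp at this
    obtain ⟨x, hx, hxb⟩ : ∃ x : K, (∀ τ ∈ T.erase ν, τ x ≤ 1) ∧
        ¬ ∃ b ∉ P, ∃ y, algebraMap O K b * x = algebraMap O K y := by
      by_contra! h
      refine hng ⟨fun τ hτ => hTS τ (Finset.mem_of_mem_erase hτ), fun x hx => ?_⟩
      exact h x hx
    have hνx : 1 < ν x := by
      by_contra! h
      refine hxb (hTx x fun τ hτ => ?_)
      by_cases hτν : τ = ν
      · exact hτν ▸ h
      · exact hx τ (Finset.mem_erase.mpr ⟨hτν, hτ⟩)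
    have hνa : ν (algebraMap O K a) < 1 := (hνP a).mpr haP
    have hνa0 : ν (algebraMap O K a) ≠ 0 := by rwa [Valuation.ne_zero_iff]
    have hνx0 : ν x ≠ 0 := (zero_lt_one.trans hνx).ne'
    -- Take `k = log ν(x)` and `l = -log ν(a)`. Then `x ^ l * a ^ k` is a unit at `ν` but has value
    -- below `1` at the rest of `T`: written as `y / b` with `b ∉ P`, it has `y ∈ P` by `μ` and `y ∉
    -- P` by `ν`.
    obtain ⟨k, l, hk, hkl⟩ : ∃ k l : ℕ, k ≠ 0 ∧ ν x ^ l * ν (algebraMap O K a) ^ k = 1 := by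
      have hp := WithZero.exp_log hνx0
      have hq := WithZero.exp_log hνa0
      set p := WithZero.log (ν x)
      set q := WithZero.log (ν (algebraMap O K a))
      rw [← hp, ← WithZero.exp_zero, WithZero.exp_lt_exp] at hνx
      rw [← hq, ← WithZero.exp_zero, WithZero.exp_lt_exp] at hνa
      refine ⟨p.toNat, (-q).toNat, by omega, ?_⟩
      rw [← hp, ← hq, ← WithZero.exp_nsmul, ← WithZero.exp_nsmul, ← WithZero.exp_add,
        ← WithZero.exp_zero]
      congr 1
      rw [nsmul_eq_mul, nsmul_eq_mul, Int.toNat_of_nonneg (by omega), Int.toNat_of_nonneg (by omega)]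
      ring
    have hlt : ∀ τ ∈ T, τ ≠ ν → τ (x ^ l * algebraMap O K a ^ k) < 1 := by
      intro τ hτ hτν
      rw [map_mul, map_pow, map_pow]
      exact (mul_le_of_le_one_left' (pow_le_one' (hx τ (Finset.mem_erase.mpr ⟨hτν, hτ⟩)) l)).trans_lt
        (pow_lt_one₀ zero_le (((hTS τ hτ).2 a).mpr haP) hk)
    obtain ⟨b, hb, y, hy⟩ := hTx (x ^ l * algebraMap O K a ^ k) fun τ hτ => by
      by_cases hτν : τ = ν
      · rw [hτν, map_mul, map_pow, map_pow, hkl]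
      · exact (hlt τ hτ hτν).le
    have hyP : y ∈ P := by
      rw [← (hTS μ hμT).2, ← hy, map_mul]
      exact (mul_le_of_le_one_left' (hle μ (hTS μ hμT).1 b)).trans_lt (hlt μ hμT hμν)
    rw [← hνP, ← hy, map_mul, map_mul, map_pow, map_pow, hkl, mul_one, hνP] at hyP
    exact hb hyP
  exact ⟨ν, hsurj ν hνS, hle ν hνS, hνP,
    fun x hx => hTx x fun τ hτ => (honly τ hτ).symm ▸ hx⟩

end Krull

/-! ### Symmetrizing forms under extension of scalars. -/

section Form

variable {O : Type u} {A : Type x} [CommRing O] [Ring A] [Algebra O A] {t : A →ₗ[O] O}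

theorem IsSymmetrizingForm.exists_dual_bases [Module.Free O A] [Module.Finite O A]
    (ht : IsSymmetrizingForm t) :
    ∃ (n : ℕ) (β β' : Fin n → A), ∀ w, ∑ j, t (β' j * w) • β j = w := by
  let b := (Module.Free.chooseBasis O A).reindex (Fintype.equivFin _)
  choose β' hβ' using fun j => ht.bijective.2 (b.coord j)
  refine ⟨_, b, β', fun w => ?_⟩
  conv_rhs => rw [← b.sum_repr w]
  refine Finset.sum_congr rfl fun j _ => ?_
  congr 1
  exact LinearMap.congr_fun (hβ' j) w

variable (F : Type v) [Field F] [Algebra O F]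

@[simp]
theorem extendForm_tmul (t : A →ₗ[O] O) (c : F) (a : A) :
    extendForm F t (c ⊗ₜ a) = algebraMap O F (t a) * c := by
  simp [extendForm, Algebra.smul_def]

theorem IsSymmetrizingForm.extendForm_comm (ht : IsSymmetrizingForm t) (a b : F ⊗[O] A) :
    extendForm F t (a * b) = extendForm F t (b * a) := by
  induction a with
  | zero => simp
  | add x y hx hy => rw [add_mul, mul_add, map_add, map_add, hx, hy]
  | tmul c a =>
    induction b with
    | zero => simp
    | add x y hx hy => rw [add_mul, mul_add, map_add, map_add, hx, hy]
    | tmul c' a' => simp [ht.trace_comm a a', mul_comm c c']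

theorem extendForm_dual_bases {n : ℕ} {β β' : Fin n → A}
    (h : ∀ w, ∑ j, t (β' j * w) • β j = w) (w : F ⊗[O] A) :
    ∑ j, extendForm F t ((1 ⊗ₜ β' j) * w) • ((1 : F) ⊗ₜ[O] β j) = w := by
  induction w with
  | zero => simp
  | add x y hx hy =>
    simp only [mul_add, map_add, add_smul, Finset.sum_add_distrib]
    rw [hx, hy]
  | tmul c a =>
    conv_rhs => rw [← h a, TensorProduct.tmul_sum]
    refine Finset.sum_congr rfl fun j _ => ?_
    rw [Algebra.TensorProduct.tmul_mul_tmul, extendForm_tmul, one_mul, TensorProduct.smul_tmul',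
      TensorProduct.tmul_smul, ← algebraMap_smul F (t (β' j * a)), TensorProduct.smul_tmul',
      smul_eq_mul, smul_eq_mul, mul_one]

end Form

/-! ### Reducing integral representations to `L`. -/

section Specialization

variable {O : Type u} {R : Type*} {K : Type v} {L : Type w} {A : Type x}
  [CommRing O] [CommRing R] [Field K] [Algebra O R] [Algebra O K] [Algebra R K]
  [IsScalarTower O R K] [Ring A] [Algebra O A] {t : A →ₗ[O] O}
  {ι : Type*} [Fintype ι] [DecidableEq ι] {d : ι → ℕ}
  {φ : (K ⊗[O] A) ≃ₐ[K] Π i, Matrix (Fin (d i)) (Fin (d i)) K}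
  {ρ : ∀ i, A →ₐ[O] Matrix (Fin (d i)) (Fin (d i)) R} {c : ι → K}
  [Field L] [Algebra O L] [Algebra R L] [IsScalarTower O R L]

variable (L) in
/-- The reduction to `L` of a representation over `R`. -/
noncomputable def reduceRep {n : ℕ} (σ : A →ₐ[O] Matrix (Fin n) (Fin n) R) :
    (L ⊗[O] A) →ₐ[L] Matrix (Fin n) (Fin n) L :=
  Algebra.TensorProduct.lift (Algebra.ofId L _)
    ((IsScalarTower.toAlgHom O R L).mapMatrix.comp σ)
    fun l x => Algebra.commute_algebraMap_left l
      (((IsScalarTower.toAlgHom O R L).mapMatrix.comp σ) x)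

@[simp]
theorem reduceRep_tmul {n : ℕ} (σ : A →ₐ[O] Matrix (Fin n) (Fin n) R) (l : L) (a : A) :
    reduceRep L σ (l ⊗ₜ a) = l • (σ a).map (algebraMap R L) := by
  rw [Algebra.smul_def]
  exact Algebra.TensorProduct.lift_tmul _ _ _ l a

/-- If a Schur element vanishes under specialization, the relative trace vanishes in the
reduction of the corresponding representation. -/
theorem reduceRep_casimir_eq_zero (hRK : Function.Injective (algebraMap R K))
    {m : ℕ} {β β' : Fin m → A} (hβ : ∀ w, ∑ j, t (β' j * w) • β j = w)
    (hρ : ∀ i a, (ρ i a).map (algebraMap R K) = φ (1 ⊗ₜ a) i)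
    (hc : ∀ b, extendForm K t b = ∑ i, c i * (φ b i).trace) {i : ι} (hci : c i ≠ 0) {s : O}
    (hs : algebraMap O K s = (c i)⁻¹) (hsL : algebraMap O L s = 0) (a : L ⊗[O] A) :
    reduceRep L (ρ i) (∑ j, (1 ⊗ₜ β j) * a * (1 ⊗ₜ β' j)) = 0 := by
  induction a with
  | zero => simp
  | add x y hx hy =>
    simp only [mul_add, add_mul, Finset.sum_add_distrib, map_add] at *
    rw [hx, hy, add_zero]
  | tmul l a =>
    -- The Casimir identity over `K`, with `s = (c i)⁻¹`, descends to `R` by injectivity.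
    have key : ∑ j, ρ i (β j) * ρ i a * ρ i (β' j) =
        (algebraMap O R s * (ρ i a).trace) • (1 : Matrix (Fin (d i)) (Fin (d i)) R) := by
      apply Matrix.map_injective hRK
      have h1 := casimir_matrix hc (extendForm_dual_bases K hβ) i ((ρ i a).map (algebraMap R K))
      have h2 : (∑ j, ρ i (β j) * ρ i a * ρ i (β' j)).map (algebraMap R K) =
          ∑ j, φ (1 ⊗ₜ β j) i * (ρ i a).map (algebraMap R K) * φ (1 ⊗ₜ β' j) i := by
        simp only [← hρ, ← RingHom.mapMatrix_apply, map_sum, map_mul]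
      beta_reduce
      rw [h2]
      apply smul_right_injective _ hci
      simp only [h1]
      ext p q
      simp only [Matrix.smul_apply, Matrix.map_apply, smul_eq_mul, map_mul,
        ← IsScalarTower.algebraMap_apply, hs]
      rw [mul_assoc (c i)⁻¹, mul_inv_cancel_left₀ hci]
      simp [Matrix.one_apply, apply_ite (algebraMap R K), Matrix.trace]
    have h3 : reduceRep L (ρ i) (∑ j, (1 ⊗ₜ β j) * (l ⊗ₜ a) * (1 ⊗ₜ β' j)) =
        l • (∑ j, ρ i (β j) * ρ i a * ρ i (β' j)).map (algebraMap R L) := by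
      simp only [← RingHom.mapMatrix_apply, map_sum, map_mul, reduceRep_tmul, Finset.smul_sum,
        one_smul, mul_smul_comm, smul_mul_assoc]
    rw [h3, key]
    ext p q
    simp [← IsScalarTower.algebraMap_apply, hsL]

/-- If no Schur element vanishes under specialization, the common kernel of the reductions of
the simple representations is zero. -/
theorem eq_zero_of_reduceRep_eq_zero (hRK : Function.Injective (algebraMap R K))
    {m : ℕ} {β β' : Fin m → A} (hβ : ∀ w, ∑ j, t (β' j * w) • β j = w)
    (hρ : ∀ i a, (ρ i a).map (algebraMap R K) = φ (1 ⊗ₜ a) i)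
    (hc : ∀ b, extendForm K t b = ∑ i, c i * (φ b i).trace) (hc0 : ∀ i, c i ≠ 0) {s : ι → O}
    (hs : ∀ i, algebraMap O K (s i) = (c i)⁻¹) (hsL : ∀ i, algebraMap O L (s i) ≠ 0)
    {a : L ⊗[O] A} (ha : ∀ i, reduceRep L (ρ i) a = 0) : a = 0 := by
  -- Multiplying `t^K = ∑ sᵢ⁻¹ trᵢ` by `∏ sᵢ` leaves an identity over `R`, which can be mapped to
  -- `L`.
  have hR : ∀ a : A, algebraMap O R ((∏ i, s i) * t a) =
      ∑ i, algebraMap O R (∏ j ∈ Finset.univ.erase i, s j) * (ρ i a).trace := by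
    intro a
    apply hRK
    have h1 := hc (1 ⊗ₜ a)
    rw [extendForm_tmul, mul_one] at h1
    rw [← IsScalarTower.algebraMap_apply, map_mul, h1, Finset.mul_sum, map_sum]
    refine Finset.sum_congr rfl fun i _ => ?_
    have h2 : (φ (1 ⊗ₜ a) i).trace = algebraMap R K (ρ i a).trace := by
      rw [← hρ]
      simp [Matrix.trace]
    rw [← Finset.mul_prod_erase _ _ (Finset.mem_univ i), h2, map_mul (algebraMap R K),
      ← IsScalarTower.algebraMap_apply, map_mul, hs]
    field_simp [hc0 i]
  have hL : ∀ b : L ⊗[O] A, algebraMap O L (∏ i, s i) * extendForm L t b =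
      ∑ i, algebraMap O L (∏ j ∈ Finset.univ.erase i, s j) * (reduceRep L (ρ i) b).trace := by
    intro b
    induction b with
    | zero => simp
    | add x y hx hy =>
      simp only [map_add, mul_add, hx, hy, Matrix.trace_add, Finset.sum_add_distrib]
    | tmul l a =>
      have h1 := congr_arg (algebraMap R L) (hR a)
      rw [← IsScalarTower.algebraMap_apply, map_mul, map_sum] at h1
      rw [extendForm_tmul, ← mul_assoc, h1, Finset.sum_mul]
      refine Finset.sum_congr rfl fun i _ => ?_
      have h2 : ((ρ i a).map (algebraMap R L)).trace = algebraMap R L (ρ i a).trace := by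
        simp [Matrix.trace]
      rw [reduceRep_tmul, Matrix.trace_smul, h2, map_mul, ← IsScalarTower.algebraMap_apply,
        smul_eq_mul]
      ring
  have hprod : algebraMap O L (∏ i, s i) ≠ 0 := by
    rw [map_prod]
    exact Finset.prod_ne_zero_iff.mpr fun i _ => hsL i
  rw [← extendForm_dual_bases L hβ a]
  refine Finset.sum_eq_zero fun j _ => ?_
  have : extendForm L t ((1 ⊗ₜ β' j) * a) = 0 := by
    refine (mul_eq_zero.mp ((hL _).trans ?_)).resolve_left hprod
    simp [ha]
  rw [this, zero_smul]

end Specialization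

/-! ### Integrality of Schur elements and the criterion. -/

section Main

variable {O : Type u} {K : Type v} {L : Type w} {A : Type x}
  [CommRing O] [IsDomain O] [Field K] [Algebra O K] [IsFractionRing O K]
  [Ring A] [Algebra O A] [Module.Free O A] [Module.Finite O A]

/-- Over a Krull ring, the Schur element of a simple module is well defined and integral. -/
theorem exists_schurElement (hO : IsKrullRing O K)
    (hKA : IsSplitSemisimple K (K ⊗[O] A)) {t : A →ₗ[O] O} (ht : IsSymmetrizingForm t)
    (V : Type (max v x)) [AddCommGroup V] [Module (K ⊗[O] A) V] [Module K V]
    [IsScalarTower K (K ⊗[O] A) V] (hV : IsSimpleModule (K ⊗[O] A) V) :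
    ∃ s : O, ∀ s' : K, IsSchurElement (extendForm K t) V s' ↔ s' = algebraMap O K s := by
  obtain ⟨n, d, hd, ⟨φ⟩⟩ := hKA.exists_algEquiv
  obtain ⟨m, β, β', hβ⟩ := ht.exists_dual_bases
  have hβK := extendForm_dual_bases K hβ
  have hτ := ht.extendForm_comm K
  obtain ⟨c, hc⟩ := exists_eq_sum_mul_trace φ (extendForm K t) hτ
  obtain ⟨i, e, he⟩ := exists_intertwiner_of_isSimpleModule φ V hV
  have hSchur := isSchurElement_iff hc hβK hτ he
  obtain ⟨S, -, hint, -⟩ := hO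
  -- over each valuation ring the representation on `V` is integral
  have hlattice : ∀ ν ∈ S, ∃ (i : Fin n) (ψ : (K ⊗[O] A) ≃ₐ[K]
      Π i, Matrix (Fin (d i)) (Fin (d i)) K) (e : (Fin (d i) → K) ≃ₗ[K] V),
      (∀ (b : K ⊗[O] A) (f : Fin (d i) → K), e (Matrix.mulVec (ψ b i) f) = b • e f) ∧
      ∀ a p q, ν (ψ (1 ⊗ₜ a) i p q) ≤ 1 := by
    intro ν hν
    let : Algebra O ν.valuationSubring := ((algebraMap O K).codRestrict ν.valuationSubring
      fun x => (hint _).mpr ⟨x, rfl⟩ ν hν).toAlgebra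
    have : IsScalarTower O ν.valuationSubring K := IsScalarTower.of_algebraMap_eq fun _ => rfl
    have := isPrincipalIdealRing_valuationSubring ν
    obtain ⟨ψ, ρ, hρ⟩ := exists_integral_splitting ν.valuationSubring φ
    obtain ⟨i, e, he⟩ := exists_intertwiner_of_isSimpleModule ψ V hV
    refine ⟨i, ψ, e, he, fun a p q => ?_⟩
    rw [← hρ]
    exact (ρ i a p q).2
  have hχ : ∀ a : A, ∃ y : O, algebraMap O K y = moduleCharacter K (K ⊗[O] A) V (1 ⊗ₜ a) := by
    intro a
    refine (hint _).mp fun ν hν => ?_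
    obtain ⟨i, ψ, e, he, hle⟩ := hlattice ν hν
    rw [moduleCharacter_eq_trace he]
    exact ν.map_sum_le fun p _ => hle a p p
  choose χ hχ using hχ
  have hinj := FaithfulSMul.algebraMap_injective O K
  let χl : A →ₗ[O] O :=
    { toFun := χ
      map_add' := fun a b => hinj (by
        rw [map_add, hχ, hχ, hχ, TensorProduct.tmul_add, map_add])
      map_smul' := fun r a => hinj (by
        rw [RingHom.id_apply, smul_eq_mul, map_mul, hχ, hχ, TensorProduct.tmul_smul,
          ← algebraMap_smul K r, map_smul, smul_eq_mul]) }
  -- Since `t` is nondegenerate over `O` itself, `χ_V^∨` has the form `1 ⊗ z` with `z` in `A`.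
  obtain ⟨z, hz⟩ := ht.bijective.2 χl
  have hzχ : ∀ b, extendForm K t ((1 ⊗ₜ z) * b) = moduleCharacter K (K ⊗[O] A) V b := by
    intro b
    induction b with
    | zero => simp
    | add x y hx hy => rw [mul_add, map_add, map_add, hx, hy]
    | tmul l a =>
      have h1 : t (z * a) = χ a := LinearMap.congr_fun hz a
      have h2 : l ⊗ₜ[O] a = l • ((1 : K) ⊗ₜ[O] a) := by simp [TensorProduct.smul_tmul']
      rw [h2, map_smul, ← hχ, mul_smul_comm, map_smul, Algebra.TensorProduct.tmul_mul_tmul,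
        extendForm_tmul, h1, one_mul, mul_one]
  obtain ⟨z', hz', hz'V⟩ := (hSchur _).mpr rfl
  have hzz : z' = 1 ⊗ₜ z := by
    rw [← hβK z', ← hβK (1 ⊗ₜ z)]
    refine Finset.sum_congr rfl fun j _ => ?_
    rw [hτ, hz', hτ, hzχ]
  obtain ⟨s, hs⟩ : (c i)⁻¹ ∈ Set.range (algebraMap O K) := by
    refine (hint _).mp fun ν hν => ?_
    obtain ⟨l, ψ, e', he', hle⟩ := hlattice ν hν
    have h1 := he' (1 ⊗ₜ z) (Pi.single 0 1)
    rw [← hzz, hz'V, ← map_smul] at h1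
    have h2 := congr_fun (e'.injective h1) 0
    have h3 : ψ (1 ⊗ₜ z) l 0 0 = (c i)⁻¹ := by
      rw [hzz] at h2
      simpa using h2
    rw [← h3]
    exact hle z 0 0
  exact ⟨s, fun s' => by rw [hSchur, hs]⟩

end Main

theorem mainTheorem7 {O : Type u} {K : Type v} {L : Type w} {A : Type x}
    [CommRing O] [IsDomain O] [Field K] [Algebra O K] [IsFractionRing O K]
    (hO : IsKrullRing O K)
    [Ring A] [Algebra O A] [Module.Free O A] [Module.Finite O A]
    (hKA : IsSplitSemisimple K (K ⊗[O] A))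
    (t : A →ₗ[O] O) (ht : IsSymmetrizingForm t)
    [Field L] [Algebra O L] (hθ : IsSpecialization (algebraMap O L))
    (hker : (RingHom.ker (algebraMap O L)).height = 1) :
    -- the Schur element of every simple `KA`-module is well defined and lies in `O`
    (∀ (V : Type (max v x)) [AddCommGroup V] [Module (K ⊗[O] A) V] [Module K V]
      [IsScalarTower K (K ⊗[O] A) V], IsSimpleModule (K ⊗[O] A) V →
        (∃! s : K, IsSchurElement (extendForm K t) V s) ∧
        ∃! s : O, IsSchurElement (extendForm K t) V (algebraMap O K s)) ∧
    (IsSplitSemisimple L (L ⊗[O] A) ↔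
      ∀ (V : Type (max v x)) [AddCommGroup V] [Module (K ⊗[O] A) V] [Module K V]
        [IsScalarTower K (K ⊗[O] A) V], IsSimpleModule (K ⊗[O] A) V →
          ∀ s : O, IsSchurElement (extendForm K t) V (algebraMap O K s) →
            algebraMap O L s ≠ 0) := by
  have hinj := FaithfulSMul.algebraMap_injective O K
  refine ⟨fun V _ _ _ _ hV => ?_, ?_⟩
  · obtain ⟨s, hs⟩ := exists_schurElement hO hKA ht V hV
    exact ⟨⟨_, (hs _).mpr rfl, fun s' h => (hs s').mp h⟩,
      ⟨s, (hs _).mpr rfl, fun s' h => hinj ((hs _).mp h)⟩⟩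
  have hP : (RingHom.ker (algebraMap O L)).IsPrime := RingHom.ker_isPrime _
  obtain ⟨ν, -, hνle, hνP, hνloc⟩ := hO.exists_valuation _ hker
  let R := ν.valuationSubring
  let : Algebra O R := ((algebraMap O K).codRestrict R hνle).toAlgebra
  have : IsScalarTower O R K := IsScalarTower.of_algebraMap_eq fun _ => rfl
  have := isPrincipalIdealRing_valuationSubring ν
  have hRK : Function.Injective (algebraMap R K) := Subtype.val_injective
  have hloc : IsLocalization.AtPrime R (RingHom.ker (algebraMap O L)) := by
    refine (isLocalization_iff _ _).mpr ⟨?_, ?_, ?_⟩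
    · rintro ⟨b, hb⟩
      have h1 : ν (algebraMap O K b) = 1 :=
        le_antisymm (hνle b) (not_lt.mp fun h => hb ((hνP b).mp h))
      exact (Valuation.valuationSubring.integers ν).isUnit_iff_valuation_eq_one.mpr h1
    · intro r
      obtain ⟨b, hb, y, hy⟩ := hνloc r.1 r.2
      refine ⟨⟨y, b, hb⟩, Subtype.ext ?_⟩
      change r.1 * algebraMap O K b = algebraMap O K y
      rw [← hy, mul_comm]
    · intro p q hpq
      have : p = q := hinj (congr_arg (algebraMap R K) hpq)
      exact ⟨1, by rw [this]⟩
  -- Elements outside the kernel of `θ` become units of `L`, so `θ` extends to `R`.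
  let : Algebra R L := (IsLocalization.lift (M := (RingHom.ker (algebraMap O L)).primeCompl)
    (g := algebraMap O L) fun b => isUnit_iff_ne_zero.mpr b.2).toAlgebra
  have : IsScalarTower O R L :=
    IsScalarTower.of_algebraMap_eq fun o => (IsLocalization.lift_eq _ o).symm
  obtain ⟨n, d, hd, ⟨φ₀⟩⟩ := hKA.exists_algEquiv
  obtain ⟨φ, ρ, hρ⟩ := exists_integral_splitting R φ₀
  obtain ⟨m, β, β', hβ⟩ := ht.exists_dual_bases
  have hβK := extendForm_dual_bases K hβ
  have hβL := extendForm_dual_bases L hβ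
  have hτ := ht.extendForm_comm K
  obtain ⟨c, hc⟩ := exists_eq_sum_mul_trace φ (extendForm K t) hτ
  have hc0 := coeff_ne_zero hc hβK
  constructor
  · intro hLA V _ _ _ _ hV s hs hs0
    obtain ⟨i, e, he⟩ := exists_intertwiner_of_isSimpleModule φ V hV
    rw [isSchurElement_iff hc hβK hτ he] at hs
    obtain ⟨n', d', hd', ⟨φL⟩⟩ := hLA.exists_algEquiv
    obtain ⟨c', hc'⟩ := exists_eq_sum_mul_trace φL (extendForm L t) (ht.extendForm_comm L)
    obtain ⟨a, ha⟩ := exists_casimir_eq_one hc' hβL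
    have h0 := reduceRep_casimir_eq_zero (L := L) hRK hβ hρ hc (hc0 i) hs hs0 a
    rw [ha, map_one] at h0
    exact one_ne_zero h0
  · intro h
    have hs : ∀ i, ∃ s : O, algebraMap O K s = (c i)⁻¹ ∧ algebraMap O L s ≠ 0 := by
      intro i
      have := hKA.1
      obtain ⟨V, hV, e, he⟩ := exists_simpleModule_intertwiner φ i
      have hSchur := isSchurElement_iff hc hβK hτ he
      obtain ⟨s, hs⟩ := exists_schurElement hO hKA ht V hV
      exact ⟨s, (hSchur _).mp ((hs _).mpr rfl), h V hV s ((hs _).mpr rfl)⟩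
    choose s hs hsL using hs
    let Φ : (L ⊗[O] A) →ₐ[L] Π i, Matrix (Fin (d i)) (Fin (d i)) L :=
      AlgHom.pi fun i => reduceRep L (ρ i)
    have hΦ : Function.Injective Φ := by
      rw [injective_iff_map_eq_zero]
      exact fun a ha => eq_zero_of_reduceRep_eq_zero hRK hβ hρ hc hc0 hs hsL
        fun i => congr_fun ha i
    -- Both dimensions equal the rank of `A`, so injectivity of `Φ` suffices.
    have hdim : Module.finrank L (L ⊗[O] A) =
        Module.finrank L (Π i, Matrix (Fin (d i)) (Fin (d i)) L) := by
      have h1 := φ.toLinearEquiv.finrank_eq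
      rw [Module.finrank_baseChange] at h1 ⊢
      rw [h1]
      simp [Module.finrank_pi_fintype, Module.finrank_matrix]
    have hΦ' : Function.Surjective Φ :=
      (LinearMap.injective_iff_surjective_of_finrank_eq_finrank
        (f := Φ.toLinearMap) hdim).mp hΦ
    exact isSplitSemisimple_of_algEquiv (AlgEquiv.ofBijective Φ ⟨hΦ, hΦ'⟩)
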